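/- Let $\varphi:(0,1)\to[0,\infty)$ satisfy: (P1) $\int_0^1\varphi^2<\infty$; (P2) $\varphi$ is discontinuous only on a Lebesgue null set; (P3) for some $a\in[0,1/2)$, $\varphi$ is nonincreasing on $(0,a)$, nondecreasing on $(1-a,1)$ and bounded on $(a,1-a)$; (P4) $\int_{1-x}^1\varphi>0$ for all $x\in(0,1]$. For real data $Y_1,\dots,Y_n$ let $Y_{(1)},\dots,Y_{(n)}$ be the data ordered by absolute value, $|Y_{(1)}|\le\dots\le|Y_{(n)}|$, let $c_i=\varphi(i/(n+1))$, and for $x>0$ write $I_n(x)=\{i\in\{1,\dots,n\}: i\ge\lceil(1-x)(n+1)\rceil\}$ and $$T_n(x)=\sum_{i\in I_n(x)}c_i\mathbf 1\{Y_{(i)}>0\}.$$ For $\Gamma\ge1$ let $\rho_\Gamma=\Gamma/(1+\Gamma)$ and $\sigma_n^2(x)=\rho_\Gamma(1-\rho_\Gamma)\sum_{i\in I_n(x)}c_i^2$. Given a level $\alpha\in(0,1)$ and a fixed tuning parameter $x_0>0$, the uniform general signed rank test at sensitivity parameter $\Gamma$ (defined when $\sigma_n^2(x_0)>0$, and taken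 not to reject otherwise) rejects if $T_n(x)\ge f_{\alpha,n}(x)$ for some $x\in(0,1)$, where $$f_{\alpha,n}(x)=\frac1{\lambda_n}\Big[\log\frac1\alpha+\sum_{i\in I_n(x)}\log\big(1+\rho_\Gamma(e^{c_i\lambda_n}-1)\big)\Big],\qquad \lambda_n=\sqrt{\frac{2\log\alpha^{-1}}{\sigma_n^2(x_0)}}.$$ Its power under $H_1(G)$ is the probability of rejection when $Y_1,\dots,Y_n$ are i.i.d. with distribution $G$. The design sensitivity is the value $\widetilde\Gamma\in[0,\infty]$ such that, as $n\to\infty$, the power tends to $1$ for every $\Gamma$ with $1\le\Gamma<\widetilde\Gamma$ and to $0$ for every $\Gamma\ge 1$ with $\widetilde\Gamma<\Gamma<\infty$. Let $G=\mathcal N(\tau,\sigma^2)$ with $\tau>0$ and $\sigma>0$. Then $$\widetilde\Gamma_{\varphi,\mathrm{unif}}:=\sup_{x\in(0,1)}\frac{\pi(x)}{1-\pi(x)}=\infty,\qquad \pi(x)=\frac{\int_0^\infty\varphi(G(y)-G(-y))\,\mathbf 1\{G(y)-G(-y)\ge1-x\}\,dG(y)}{\int_{1-x}^1\varphi(y)\,dy},$$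 where $G(\cdot)$ also denotes the distribution function of $G$; and for every $\alpha\in(0,1)$ and every $x_0>0$ the uniform general signed rank test has design sensitivity $\infty$ under $H_1(G)$, that is, for every $\Gamma\ge1$ its power under $H_1(G)$ tends to one as $n\to\infty$. -/

import Mathlib

open MeasureTheory ProbabilityTheory Filter Topology Set
open scoped NNReal ENNReal

noncomputable section

namespace SignedRank

/-- Score functions `φ : (0,1) → [0,∞)` satisfying (P1)-(P4). The values of `φ` outside `(0,1)` play
no role. -/
structure IsScore (φ : ℝ → ℝ) : Prop where
  nonneg : ∀ q ∈ Ioo (0 : ℝ) 1, 0 ≤ φ q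
  /-- (P1) `φ` is square integrable. -/
  sq_integrable : IntegrableOn (fun q => φ q ^ 2) (Ioo 0 1)
  /-- (P2) `φ` is discontinuous only on a Lebesgue null set. -/
  ae_continuous : volume {q ∈ Ioo (0 : ℝ) 1 | ¬ ContinuousAt φ q} = 0
  /-- (P3) monotone near the end points, bounded in between. -/
  tails : ∃ a ∈ Ico (0 : ℝ) (1 / 2),
    AntitoneOn φ (Ioo 0 a) ∧ MonotoneOn φ (Ioo (1 - a) 1) ∧ ∃ M, ∀ q ∈ Ioo a (1 - a), φ q ≤ M
  /-- (P4) positive mass near `1`. -/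
  mass_pos : ∀ x ∈ Ioc (0 : ℝ) 1, 0 < ∫ q in (1 - x)..1, φ q

/-- `ordered y i` is the entry of `y` whose absolute value has rank `i + 1` among
`|y 0|, …, |y (n-1)|`, in increasing order. -/
def ordered {n : ℕ} (y : Fin n → ℝ) (i : Fin n) : ℝ :=
  y (Tuple.sort (fun j => |y j|) i)

/-- The coefficient `φ (k / (n+1))` of rank `k = i + 1`. -/
def coeff (φ : ℝ → ℝ) (n : ℕ) (i : Fin n) : ℝ :=
  φ (((i : ℕ) + 1 : ℝ) / ((n : ℝ) + 1))

/-- The ranks `k = i + 1` in `{1, …, n}` with `⌈(1 - x)(n + 1)⌉ ≤ k`. It is empty for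
`x < 1 / (n + 1)`. -/
def topRanks (n : ℕ) (x : ℝ) : Finset (Fin n) :=
  Finset.univ.filter fun i => ⌈(1 - x) * ((n : ℝ) + 1)⌉ ≤ ((i : ℕ) : ℤ) + 1

/-- The truncated signed rank statistic `T_n(x)`. -/
def stat (φ : ℝ → ℝ) {n : ℕ} (y : Fin n → ℝ) (x : ℝ) : ℝ :=
  ∑ i ∈ topRanks n x, coeff φ n i * (if 0 < ordered y i then 1 else 0)

/-- `ρ_Γ = Γ / (1 + Γ)`. -/
def rho (Γ : ℝ) : ℝ := Γ / (1 + Γ)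

/-- The worst-case null variance `σ_n²(x)` of `T_n(x)`. -/
def nullVar (φ : ℝ → ℝ) (Γ : ℝ) (n : ℕ) (x : ℝ) : ℝ :=
  rho Γ * (1 - rho Γ) * ∑ i ∈ topRanks n x, coeff φ n i ^ 2

/-- `λ_n = √(2 log α⁻¹ / σ_n²(x₀))`. -/
def lam (φ : ℝ → ℝ) (α x₀ Γ : ℝ) (n : ℕ) : ℝ :=
  Real.sqrt (2 * Real.log α⁻¹ / nullVar φ Γ n x₀)

/-- The uniform threshold `f_{α,n}(x)`. -/
def threshold (φ : ℝ → ℝ) (α x₀ Γ : ℝ) (n : ℕ) (x : ℝ) : ℝ :=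
  1 / lam φ α x₀ Γ n * (Real.log (1 / α) +
    ∑ i ∈ topRanks n x, Real.log (1 + rho Γ * (Real.exp (coeff φ n i * lam φ α x₀ Γ n) - 1)))

/-- The uniform general signed rank test with tuning parameter `x₀` rejects on the data `y`. It is
only defined if `σ_n²(x₀) > 0`; otherwise it is taken not to reject. -/
def Rejects (φ : ℝ → ℝ) (α x₀ Γ : ℝ) {n : ℕ} (y : Fin n → ℝ) : Prop :=
  0 < nullVar φ Γ n x₀ ∧ ∃ x ∈ Ioo (0 : ℝ) 1, threshold φ α x₀ Γ n x ≤ stat φ y x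

/-- The power of the uniform test of `H₀(Γ)` under `H₁(G)`: the probability of rejection when the
`n` pair differences are drawn independently from `G`. -/
def power (φ : ℝ → ℝ) (G : Measure ℝ) (α x₀ Γ : ℝ) (n : ℕ) : ℝ :=
  (Measure.pi fun _ : Fin n => G).real {y | Rejects φ α x₀ Γ y}

/-- `Γ'` is the design sensitivity of a family of sensitivity analyses, where `pow Γ n` is the power
at sensitivity parameter `Γ` with `n` pairs. -/
def IsDesignSensitivity (pow : ℝ → ℕ → ℝ) (Γ' : ℝ≥0∞) : Prop :=
  (∀ Γ : ℝ, 1 ≤ Γ → ENNReal.ofReal Γ < Γ' → Tendsto (pow Γ) atTop (𝓝 1)) ∧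
  (∀ Γ : ℝ, 1 ≤ Γ → Γ' < ENNReal.ofReal Γ → Tendsto (pow Γ) atTop (𝓝 0))

/-- `H(y) = G(y) - G(-y)`, the distribution function of `|Y|` for `Y ∼ G` continuous. -/
def absCdf (G : Measure ℝ) (y : ℝ) : ℝ := cdf G y - cdf G (-y)

/-- `π(x) = ∫_0^∞ φ(H(y)) 1{H(y) ≥ 1 - x} dG(y) / ∫_{1-x}^1 φ(y) dy`. -/
def propPos (φ : ℝ → ℝ) (G : Measure ℝ) (x : ℝ) : ℝ≥0∞ :=
  (∫⁻ y in Ioi (0 : ℝ) ∩ {y | 1 - x ≤ absCdf G y}, ENNReal.ofReal (φ (absCdf G y)) ∂G) /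
    ∫⁻ q in Ioo (1 - x) 1, ENNReal.ofReal (φ q)

/-- `sup_{x ∈ (0,1)} π(x) / (1 - π(x))`. -/
def unifSensitivity (φ : ℝ → ℝ) (G : Measure ℝ) : ℝ≥0∞ :=
  ⨆ x ∈ Ioo (0 : ℝ) 1, propPos φ G x / (1 - propPos φ G x)

end SignedRank

end

namespace SignedRank

/-! Reflecting the normal density gives `g(-y) = exp(-2τy/v) g(y)`, so an observation of large
absolute value is positive with probability close to one. Keeping only a small top fraction `x` of
the ranks therefore defeats any fixed bias `Γ`.

For the supremum, substitute `q = H(y)`, `dq = (g(y) + g(-y)) dy` in the denominator of `π(x)`. If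
`H(K) = 1 - x`, the odds `π/(1-π)` are at least `exp(2τK/v)` (`propPos_gaussianReal_ge`), and `K` is
arbitrary.

For the power, one well chosen `x` suffices. By Chebyshev all top ranks lie beyond `K`
(`pi_card_le_le`, `compl_absGe_topRanks_subset`). There each sign is nonpositive with probability at
most `η` (`NegTailLe.pi_ordered_nonpos_le`), so by Markov the statistic is close to its maximum `∑
c_i`. The threshold is at most `ρ ∑ c_i + O(√n)` (`IsScore.exists_threshold_le`), while `∑ c_i`
grows at least linearly (`IsScore.exists_le_sum_coeff`); since `ρ < 1`, the test rejects. -/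

lemma gaussianPDFReal_neg_eq (τ : ℝ) (v : ℝ≥0) (y : ℝ) :
    gaussianPDFReal τ v (-y) = Real.exp (-(2 * τ / v * y)) * gaussianPDFReal τ v y := by
  rw [gaussianPDFReal, gaussianPDFReal, mul_left_comm, ← Real.exp_add]
  congr 2
  -- For `v = 0` every quotient in the exponents is a division by zero, hence `0`.
  by_cases hv : (v : ℝ) = 0
  · simp [hv]
  · field_simp
    ring

/-- For a Gaussian with nonnegative mean, a symmetric set outside `(-K, K)` carries only a small
proportion of its mass on the negative half line. -/
lemma gaussianReal_inter_Iic_le {τ : ℝ} (hτ : 0 ≤ τ) {v : ℝ≥0} (hv : v ≠ 0) {K : ℝ} {S : Set ℝ}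
    (hS : MeasurableSet S) (hneg : ∀ t ∈ S, -t ∈ S) (hK : ∀ t ∈ S, K ≤ |t|) :
    gaussianReal τ v (S ∩ Iic 0) ≤
      ENNReal.ofReal (Real.exp (-(2 * τ / v * K))) * gaussianReal τ v S := by
  have hm : MeasurableSet (S ∩ Iic (0 : ℝ)) := hS.inter measurableSet_Iic
  calc gaussianReal τ v (S ∩ Iic 0)
      = ∫⁻ t in S ∩ Iic 0, gaussianPDF τ v t := gaussianReal_apply _ hv _
    _ ≤ ∫⁻ t in S ∩ Iic 0,
          ENNReal.ofReal (Real.exp (-(2 * τ / v * K))) * gaussianPDF (-τ) v t := by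
        refine setLIntegral_mono' hm fun t ht => ?_
        have h1 : gaussianPDFReal (-τ) v t = gaussianPDFReal τ v (-t) := by
          simp only [gaussianPDFReal]
          congr 3
          ring
        rw [gaussianPDF, gaussianPDF, ← ENNReal.ofReal_mul (Real.exp_pos _).le, h1]
        apply ENNReal.ofReal_le_ofReal
        have h2 := gaussianPDFReal_neg_eq τ v (-t)
        rw [neg_neg] at h2
        rw [h2]
        refine mul_le_mul_of_nonneg_right ?_ (gaussianPDFReal_nonneg _ _ _)
        have h3 : K ≤ -t := by
          have := hK t ht.1
          rwa [abs_of_nonpos ht.2] at this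
        have h4 : 0 ≤ 2 * τ / v := by positivity
        gcongr
    _ = ENNReal.ofReal (Real.exp (-(2 * τ / v * K))) * gaussianReal (-τ) v (S ∩ Iic 0) := by
        rw [lintegral_const_mul _ (measurable_gaussianPDF _ _), gaussianReal_apply _ hv]
    _ ≤ ENNReal.ofReal (Real.exp (-(2 * τ / v * K))) * gaussianReal τ v S := by
        refine mul_le_mul' le_rfl ?_
        rw [← gaussianReal_map_neg, Measure.map_apply measurable_neg hm]
        refine measure_mono fun t ht => ?_
        simpa using hneg _ ht.1

/-! ### The distribution function of `|Y|` and the supremum of the odds -/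

lemma hasDerivAt_cdf_gaussianReal (τ : ℝ) {v : ℝ≥0} (hv : v ≠ 0) (y : ℝ) :
    HasDerivAt (fun t => cdf (gaussianReal τ v) t) (gaussianPDFReal τ v y) y := by
  have h_int := integrable_gaussianPDFReal τ v
  have hcont : Continuous (gaussianPDFReal τ v) := by
    unfold gaussianPDFReal; fun_prop
  have h : (fun t => (cdf (gaussianReal τ v) t : ℝ)) =
      fun t => cdf (gaussianReal τ v) 0 + ∫ s in (0 : ℝ)..t, gaussianPDFReal τ v s := by
    funext t
    have e : ∀ u, (cdf (gaussianReal τ v) u : ℝ) = ∫ s in Iic u, gaussianPDFReal τ v s := by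
      intro u
      rw [cdf_eq_real, measureReal_def, gaussianReal_apply_eq_integral _ hv, ENNReal.toReal_ofReal]
      exact integral_nonneg fun s => gaussianPDFReal_nonneg _ _ _
    rw [e, e, ← intervalIntegral.integral_Iic_sub_Iic h_int.integrableOn h_int.integrableOn]
    ring
  rw [h]
  exact (intervalIntegral.integral_hasDerivAt_right (hcont.intervalIntegrable _ _)
    hcont.stronglyMeasurable.stronglyMeasurableAtFilter hcont.continuousAt).const_add _

lemma hasDerivAt_absCdf_gaussianReal (τ : ℝ) {v : ℝ≥0} (hv : v ≠ 0) (y : ℝ) :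
    HasDerivAt (absCdf (gaussianReal τ v))
      (gaussianPDFReal τ v y + gaussianPDFReal τ v (-y)) y := by
  have h := (hasDerivAt_cdf_gaussianReal τ hv y).sub
    ((hasDerivAt_cdf_gaussianReal τ hv (-y)).scomp y (hasDerivAt_neg y))
  exact h.congr_deriv (by simp)

lemma strictMono_absCdf_gaussianReal (τ : ℝ) {v : ℝ≥0} (hv : v ≠ 0) :
    StrictMono (absCdf (gaussianReal τ v)) := by
  refine strictMono_of_hasDerivAt_pos (hasDerivAt_absCdf_gaussianReal τ hv) fun y => ?_
  have h1 := gaussianPDFReal_pos τ v y hv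
  have h2 := gaussianPDFReal_pos τ v (-y) hv
  linarith

lemma tendsto_absCdf (G : Measure ℝ) [IsProbabilityMeasure G] :
    Tendsto (absCdf G) atTop (𝓝 1) := by
  have h := (tendsto_cdf_atTop G).sub ((tendsto_cdf_atBot G).comp tendsto_neg_atTop_atBot)
  rw [sub_zero] at h
  exact h

lemma IsScore.lintegral_ne_top {φ : ℝ → ℝ} (hφ : IsScore φ) :
    ∫⁻ q in Ioo (0 : ℝ) 1, ENNReal.ofReal (φ q) ≠ ⊤ := by
  have h : IntegrableOn (fun q => 1 + φ q ^ 2) (Ioo (0 : ℝ) 1) :=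
    (integrableOn_const (by simp)).add hφ.sq_integrable
  refine ne_top_of_le_ne_top h.lintegral_lt_top.ne (lintegral_mono fun q => ?_)
  apply ENNReal.ofReal_le_ofReal
  nlinarith [sq_nonneg (φ q - 1)]

lemma IsScore.lintegral_ne_zero {φ : ℝ → ℝ} (hφ : IsScore φ) {x : ℝ} (hx : x ∈ Ioc (0 : ℝ) 1) :
    ∫⁻ q in Ioo (1 - x) 1, ENNReal.ofReal (φ q) ≠ 0 := by
  intro h0
  have hpos := hφ.mass_pos x hx
  rw [intervalIntegral.integral_of_le (by linarith [hx.1]), integral_Ioc_eq_integral_Ioo] at hpos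
  -- Measurability of `φ` is not part of `IsScore`; it follows here because otherwise the integral
  -- in (P4) would take the default value `0`.
  have h1 : AEMeasurable φ (volume.restrict (Ioo (1 - x) 1)) := by
    by_contra hn
    rw [integral_undef fun hi => hn hi.aemeasurable] at hpos
    exact hpos.false
  rw [lintegral_eq_zero_iff' h1.ennreal_ofReal] at h0
  refine hpos.not_ge (integral_nonpos_of_ae ?_)
  filter_upwards [h0] with q hq
  simpa using hq

/-- The proportion `π` exceeds `1 / (1 + exp (-2 τ K / v))` once `K` is the quantile of level
`1 - x`. -/
lemma propPos_gaussianReal_ge {φ : ℝ → ℝ} (hφ : IsScore φ) {τ : ℝ} (hτ : 0 ≤ τ) {v : ℝ≥0}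
    (hv : v ≠ 0) {K x : ℝ} (hx : x ∈ Ioc (0 : ℝ) 1) (hK : absCdf (gaussianReal τ v) K = 1 - x) :
    (1 + ENNReal.ofReal (Real.exp (-(2 * τ / v * K))))⁻¹ ≤ propPos φ (gaussianReal τ v) x := by
  set G := gaussianReal τ v
  set η := ENNReal.ofReal (Real.exp (-(2 * τ / v * K))) with hη
  have hmono := strictMono_absCdf_gaussianReal τ hv
  have hcont : Continuous (absCdf G) :=
    continuous_iff_continuousAt.2 fun y => (hasDerivAt_absCdf_gaussianReal τ hv y).continuousAt
  set s : Set ℝ := Ioi (0 : ℝ) ∩ {y | 1 - x ≤ absCdf G y} with hs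
  have hsm : MeasurableSet s := measurableSet_Ioi.inter (measurableSet_le measurable_const
    hcont.measurable)
  have hsub : Ioo (1 - x) 1 ⊆ absCdf G '' s := by
    intro q hq
    have h0 : absCdf G 0 = 0 := by simp [absCdf]
    obtain ⟨b, hb⟩ := ((tendsto_absCdf G).eventually (lt_mem_nhds hq.2)).exists
    have hb0 : 0 < b := by
      by_contra! hb0
      have := hmono.monotone hb0
      linarith [hq.1, hx.2]
    obtain ⟨y, hy, rfl⟩ := intermediate_value_Ioo hb0.le hcont.continuousOn
      (show q ∈ Ioo (absCdf G 0) (absCdf G b) from ⟨by linarith [hq.1, hx.2], hb⟩)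
    exact ⟨y, ⟨hy.1, hq.1.le⟩, rfl⟩
  have hD : ∫⁻ q in Ioo (1 - x) 1, ENNReal.ofReal (φ q) ≤
      (1 + η) * ∫⁻ y in s, ENNReal.ofReal (φ (absCdf G y)) ∂G := by
    calc ∫⁻ q in Ioo (1 - x) 1, ENNReal.ofReal (φ q)
        ≤ ∫⁻ q in absCdf G '' s, ENNReal.ofReal (φ q) := lintegral_mono_set hsub
      _ = ∫⁻ y in s, ENNReal.ofReal |gaussianPDFReal τ v y + gaussianPDFReal τ v (-y)| *
            ENNReal.ofReal (φ (absCdf G y)) :=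
          lintegral_image_eq_lintegral_abs_deriv_mul hsm
            (fun y _ => (hasDerivAt_absCdf_gaussianReal τ hv y).hasDerivWithinAt)
            hmono.injective.injOn _
      -- On `s` one has `y ≥ K`, so the reflected density is at most `η` times the density.
      _ ≤ ∫⁻ y in s, (1 + η) * (gaussianPDF τ v y * ENNReal.ofReal (φ (absCdf G y))) := by
          refine setLIntegral_mono' hsm fun y hy => ?_
          rw [← mul_assoc]
          gcongr
          have hp := gaussianPDFReal_nonneg τ v y
          have hKy : K ≤ y := by
            rw [← hmono.le_iff_le, hK]
            exact hy.2
          have h4 : 0 ≤ 2 * τ / v := by positivity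
          have h5 : Real.exp (-(2 * τ / v * y)) ≤ Real.exp (-(2 * τ / v * K)) := by gcongr
          rw [abs_of_nonneg (add_nonneg hp (gaussianPDFReal_nonneg _ _ _)),
            gaussianPDFReal_neg_eq, hη, gaussianPDF, ← ENNReal.ofReal_one,
            ← ENNReal.ofReal_add zero_le_one (Real.exp_pos _).le,
            ← ENNReal.ofReal_mul (by positivity)]
          apply ENNReal.ofReal_le_ofReal
          nlinarith
      _ = (1 + η) * ∫⁻ y in s, gaussianPDF τ v y * ENNReal.ofReal (φ (absCdf G y)) :=
          lintegral_const_mul' _ _ (by simp [hη])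
      _ = (1 + η) * ∫⁻ y in s, ENNReal.ofReal (φ (absCdf G y)) ∂G := by
          congr 1
          rw [show G = gaussianReal τ v from rfl, gaussianReal_of_var_ne_zero _ hv,
            -- The version without measurability of the integrand, since only the density is known
            -- to be measurable.
            restrict_withDensity hsm, lintegral_withDensity_eq_lintegral_mul_non_measurable _
              (measurable_gaussianPDF _ _)]
          · rfl
          · exact ae_of_all _ fun y => ENNReal.ofReal_lt_top
  have hfin : ∫⁻ q in Ioo (1 - x) 1, ENNReal.ofReal (φ q) ≠ ⊤ :=
    ne_top_of_le_ne_top hφ.lintegral_ne_top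
      (lintegral_mono_set (Ioo_subset_Ioo_left (by linarith [hx.2])))
  have hne := hφ.lintegral_ne_zero hx
  rw [propPos, ENNReal.le_div_iff_mul_le (Or.inl hne) (Or.inl hfin), mul_comm, ← div_eq_mul_inv]
  exact ENNReal.div_le_of_le_mul' hD

/-- With `e = exp(2τK/v)`, the lower bound on `π` is `e/(1+e)`, whose odds are exactly `e`; letting
`K` grow makes them unbounded. -/
theorem unifSensitivity_gaussianReal {φ : ℝ → ℝ} (hφ : IsScore φ) {τ : ℝ} (hτ : 0 < τ) {v : ℝ≥0}
    (hv : v ≠ 0) : unifSensitivity φ (gaussianReal τ v) = ⊤ := by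
  set G := gaussianReal τ v
  have hmono := strictMono_absCdf_gaussianReal τ hv
  have hlim : Tendsto (fun K : ℝ => ENNReal.ofReal (Real.exp (2 * τ / v * K))) atTop (𝓝 ⊤) := by
    refine ENNReal.tendsto_ofReal_nhds_top.2 (Real.tendsto_exp_atTop.comp ?_)
    exact tendsto_id.const_mul_atTop (by positivity)
  rw [eq_top_iff]
  refine le_of_tendsto hlim ?_
  filter_upwards [eventually_gt_atTop 0] with K hK
  have h0 : absCdf G 0 = 0 := by simp [absCdf]
  have hK0 : 0 < absCdf G K := h0 ▸ hmono hK
  have hK1 : absCdf G K < 1 :=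
    (hmono (lt_add_one K)).trans_le (hmono.monotone.ge_of_tendsto (tendsto_absCdf G) _)
  set x := 1 - absCdf G K with hxd
  have hx : x ∈ Ioo (0 : ℝ) 1 := ⟨by linarith, by linarith⟩
  refine le_trans ?_ (le_iSup₂ (f := fun x _ => propPos φ G x / (1 - propPos φ G x)) x hx)
  have hge := propPos_gaussianReal_ge hφ hτ.le hv (K := K) ⟨hx.1, hx.2.le⟩ (by rw [hxd]; ring)
  set e := Real.exp (2 * τ / v * K) with he
  have hepos : 0 < e := Real.exp_pos _
  have hr : (1 + ENNReal.ofReal (Real.exp (-(2 * τ / v * K))))⁻¹ =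
      ENNReal.ofReal (e / (1 + e)) := by
    rw [Real.exp_neg, ← he, ← ENNReal.ofReal_one, ← ENNReal.ofReal_add zero_le_one (by positivity),
      ← ENNReal.ofReal_inv_of_pos (by positivity)]
    congr 1
    field_simp
    ring
  rw [hr] at hge
  calc ENNReal.ofReal e = ENNReal.ofReal (e / (1 + e)) / (1 - ENNReal.ofReal (e / (1 + e))) := by
        rw [← ENNReal.ofReal_one, ← ENNReal.ofReal_sub _ (by positivity),
          ← ENNReal.ofReal_div_of_pos]
        · congr 1
          field_simp
          ring
        · rw [sub_pos, div_lt_one (by positivity)]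
          linarith
    _ ≤ _ := ENNReal.div_le_div hge (tsub_le_tsub_left hge _)

/-! ### Signs of the observations at the top ranks -/

/-- `G` is positively skewed beyond `K` with ratio `η`: a symmetric set outside `(-K, K)` carries at
most the proportion `η` of its mass on the negative half line. -/
def NegTailLe (G : Measure ℝ) (K : ℝ) (η : ℝ≥0∞) : Prop :=
  ∀ S : Set ℝ, MeasurableSet S → (∀ t ∈ S, -t ∈ S) → (∀ t ∈ S, K ≤ |t|) → G (S ∩ Iic 0) ≤ η * G S

/-- By Fubini, freeze all coordinates but the `j`-th: each slice of `B` is a symmetric set outside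
`(-K, K)`, to which the one-dimensional bound applies. -/
lemma NegTailLe.pi_inter_le {G : Measure ℝ} [IsProbabilityMeasure G] {K : ℝ} {η : ℝ≥0∞}
    (hG : NegTailLe G K η) (hη : η ≠ ⊤) {n : ℕ} (j : Fin n) {B : Set (Fin n → ℝ)} (hB : MeasurableSet B)
    (hflip : ∀ y ∈ B, Function.update y j (-y j) ∈ B) (hK : ∀ y ∈ B, K ≤ |y j|) :
    (Measure.pi fun _ : Fin n => G) (B ∩ {y | y j ≤ 0}) ≤
      η * (Measure.pi fun _ : Fin n => G) B := by
  obtain _ | m := n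
  · exact j.elim0
  have hmp := (measurePreserving_piFinSuccAbove (fun _ : Fin (m + 1) => G) j).symm
  have hpre : ∀ S : Set (Fin (m + 1) → ℝ), MeasurableSet S →
      (Measure.pi fun _ : Fin (m + 1) => G) S =
        ∫⁻ r, G {t | j.insertNth t r ∈ S} ∂(Measure.pi fun _ : Fin m => G) := by
    intro S hS
    rw [← hmp.measure_preimage hS.nullMeasurableSet,
      Measure.prod_apply_symm (hmp.measurable hS)]
    rfl
  have hslice : ∀ r : Fin m → ℝ, Measurable fun t : ℝ => (j.insertNth t r : Fin (m + 1) → ℝ) :=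
    fun r => hmp.measurable.comp (measurable_id.prodMk measurable_const)
  have hjm : MeasurableSet {y : Fin (m + 1) → ℝ | y j ≤ 0} :=
    measurableSet_le (measurable_pi_apply j) measurable_const
  rw [hpre _ (hB.inter hjm), hpre _ hB]
  rw [← lintegral_const_mul' _ _ hη]
  refine lintegral_mono fun r => ?_
  have h := hG {t : ℝ | (j.insertNth t r : Fin (m + 1) → ℝ) ∈ B} (hslice r hB) ?_ ?_
  · convert h using 2
    ext t
    simp
  · intro t ht
    simpa using hflip _ ht
  · intro t ht
    simpa using hK _ ht

/-- The sorting permutation is determined by finitely many comparisons of absolute values, with ties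
broken by index. -/
lemma measurableSet_sort_abs_eq {n : ℕ} (p : Equiv.Perm (Fin n)) :
    MeasurableSet {y : Fin n → ℝ | Tuple.sort (fun j => |y j|) = p} := by
  have h : {y : Fin n → ℝ | Tuple.sort (fun j => |y j|) = p} =
      {y | (∀ i j, i ≤ j → |y (p i)| ≤ |y (p j)|) ∧
        ∀ i j, i < j → |y (p i)| = |y (p j)| → p i < p j} := by
    ext y
    simp only [mem_ofPred_eq, eq_comm (b := p), Tuple.eq_sort_iff]
    rfl
  have hm : ∀ i, Measurable fun y : Fin n → ℝ => |y (p i)| := fun i =>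
    measurable_norm.comp (measurable_pi_apply (p i))
  rw [h]
  refine MeasurableSet.inter ?_ ?_
  · exact measurableSet_setOfPred.2 <| Measurable.forall fun i => Measurable.forall fun j =>
      Measurable.imp measurable_const (measurableSet_setOfPred.1 (measurableSet_le (hm i) (hm j)))
  · exact measurableSet_setOfPred.2 <| Measurable.forall fun i => Measurable.forall fun j =>
      Measurable.imp measurable_const <|
        Measurable.imp (measurableSet_setOfPred.1 (measurableSet_eq_fun (hm i) (hm j)))
          measurable_const

lemma measurable_ordered {n : ℕ} (i : Fin n) :
    Measurable fun y : Fin n → ℝ => ordered y i := by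
  have h : (fun y : Fin n → ℝ => ordered y i) = fun y => ∑ p : Equiv.Perm (Fin n),
      {y : Fin n → ℝ | Tuple.sort (fun j => |y j|) = p}.indicator (fun y => y (p i)) y := by
    funext y
    rw [Finset.sum_eq_single (Tuple.sort fun j => |y j|)]
    · simp [ordered]
    · intro p _ hp
      simp [hp.symm]
    · simp
  rw [h]
  exact Finset.measurable_sum _ fun p _ =>
    (measurable_pi_apply (p i)).indicator (measurableSet_sort_abs_eq p)

/-- The event that the observations of rank in `I` have absolute value at least `K`. -/
def absGe {n : ℕ} (I : Finset (Fin n)) (K : ℝ) : Set (Fin n → ℝ) :=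
  {y | ∀ i ∈ I, K ≤ |ordered y i|}

lemma measurableSet_absGe {n : ℕ} (I : Finset (Fin n)) (K : ℝ) : MeasurableSet (absGe I K) := by
  have : absGe I K = ⋂ i ∈ I, {y | K ≤ |ordered y i|} := by
    ext y
    simp [absGe]
  rw [this]
  exact Finset.measurableSet_biInter _ fun i _ =>
    measurableSet_le measurable_const (measurable_norm.comp (measurable_ordered i))

lemma abs_update_neg {n : ℕ} (y : Fin n → ℝ) (j k : Fin n) :
    |Function.update y j (-y j) k| = |y k| := by
  by_cases h : k = j
  · subst h
    simp
  · simp [h]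

lemma abs_ordered_update_neg {n : ℕ} (y : Fin n → ℝ) (j i : Fin n) :
    |ordered (Function.update y j (-y j)) i| = |ordered y i| := by
  simp only [ordered, abs_update_neg]

/-- Split by the sorting permutation `p`. On each piece the observation of rank `i` is the fixed
coordinate `p i`, and flipping its sign changes neither the absolute values nor `p`, so the slice
bound applies; then sum over `p`. -/
lemma NegTailLe.pi_ordered_nonpos_le {G : Measure ℝ} [IsProbabilityMeasure G] {K : ℝ} {η : ℝ≥0∞}
    (hG : NegTailLe G K η) (hη : η ≠ ⊤) {n : ℕ} {I : Finset (Fin n)} {i : Fin n} (hi : i ∈ I) :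
    (Measure.pi fun _ : Fin n => G) (absGe I K ∩ {y | ordered y i ≤ 0}) ≤ η := by
  set μ := Measure.pi fun _ : Fin n => G
  let f : (Fin n → ℝ) → Equiv.Perm (Fin n) := fun y => Tuple.sort fun j => |y j|
  have hf : ∀ p, MeasurableSet (f ⁻¹' {p}) := measurableSet_sort_abs_eq
  have hsum : ∀ S : Set (Fin n → ℝ), MeasurableSet S → μ S = ∑ p, μ (S ∩ f ⁻¹' {p}) := by
    intro S hS
    have h := sum_measure_preimage_singleton (μ := μ.restrict S) Finset.univ fun p _ => hf p
    simp only [Finset.coe_univ, preimage_univ, Measure.restrict_apply_univ] at h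
    rw [← h]
    exact Finset.sum_congr rfl fun p _ => by rw [Measure.restrict_apply (hf p), inter_comm]
  have hA := measurableSet_absGe I K
  calc μ (absGe I K ∩ {y | ordered y i ≤ 0})
      = ∑ p, μ (absGe I K ∩ {y | ordered y i ≤ 0} ∩ f ⁻¹' {p}) :=
        hsum _ (hA.inter (measurableSet_le (measurable_ordered i) measurable_const))
    _ ≤ ∑ p, η * μ (absGe I K ∩ f ⁻¹' {p}) := by
        refine Finset.sum_le_sum fun p _ => ?_
        refine le_trans (measure_mono ?_) (hG.pi_inter_le hη (p i) (hA.inter (hf p)) ?_ ?_)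
        · rintro y ⟨⟨hy, h0⟩, rfl⟩
          exact ⟨⟨hy, rfl⟩, h0⟩
        · rintro y ⟨hy, hp⟩
          refine ⟨fun k hk => ?_, ?_⟩
          · rw [abs_ordered_update_neg]
            exact hy k hk
          · simp only [f, mem_preimage, mem_singleton_iff, abs_update_neg]
            exact hp
        · rintro y ⟨hy, rfl⟩
          exact hy i hi
    _ = η * μ (absGe I K) := by rw [← Finset.mul_sum, ← hsum _ hA]
    _ ≤ η * 1 := mul_le_mul' le_rfl prob_le_one
    _ = η := mul_one η

/-- The truncated statistic falls short of its maximum by the proportion `ε` with small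
probability. -/
lemma NegTailLe.pi_sum_nonpos_ge_le {G : Measure ℝ} [IsProbabilityMeasure G] {K : ℝ} {η : ℝ≥0∞}
    (hG : NegTailLe G K η) (hη : η ≠ ⊤) {n : ℕ} {I : Finset (Fin n)} {c : Fin n → ℝ}
    (hc : ∀ i, 0 ≤ c i) (hI : 0 < ∑ i ∈ I, c i) {ε : ℝ} (hε : 0 < ε) :
    (Measure.pi fun _ : Fin n => G) (absGe I K ∩
      {y | ε * ∑ i ∈ I, c i ≤ ∑ i ∈ I, c i * (if ordered y i ≤ 0 then 1 else 0)}) ≤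
        η / ENNReal.ofReal ε := by
  set μ := Measure.pi fun _ : Fin n => G
  set s := ∑ i ∈ I, c i with hs
  have hm : ∀ i, MeasurableSet {y : Fin n → ℝ | ordered y i ≤ 0} := fun i =>
    measurableSet_le (measurable_ordered i) measurable_const
  let F : (Fin n → ℝ) → ℝ≥0∞ := fun y => ∑ i ∈ I,
    ENNReal.ofReal (c i) * {y : Fin n → ℝ | ordered y i ≤ 0}.indicator 1 y
  have hterm : ∀ i, Measurable fun y => ENNReal.ofReal (c i) *
      {y : Fin n → ℝ | ordered y i ≤ 0}.indicator (1 : (Fin n → ℝ) → ℝ≥0∞) y := fun i =>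
    (measurable_one.indicator (hm i)).const_mul _
  have hF : Measurable F := Finset.measurable_sum _ fun i _ => hterm i
  -- Linearity of expectation suffices: no independence between the signs of different ranks is
  -- needed.
  have h_int : ∫⁻ y, F y ∂(μ.restrict (absGe I K)) ≤ ENNReal.ofReal s * η := by
    rw [lintegral_finsetSum _ fun i _ => hterm i, hs, ENNReal.ofReal_sum_of_nonneg fun i _ => hc i,
      Finset.sum_mul]
    refine Finset.sum_le_sum fun i hi => ?_
    rw [lintegral_const_mul _ (measurable_one.indicator (hm i)), lintegral_indicator_one (hm i),
      Measure.restrict_apply (hm i), inter_comm]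
    exact mul_le_mul' le_rfl (hG.pi_ordered_nonpos_le hη hi)
  have hset : μ (absGe I K ∩
      {y | ε * s ≤ ∑ i ∈ I, c i * (if ordered y i ≤ 0 then 1 else 0)}) ≤
      μ.restrict (absGe I K) {y | ENNReal.ofReal (ε * s) ≤ F y} := by
    rw [Measure.restrict_apply (measurableSet_le measurable_const hF), inter_comm]
    refine measure_mono (inter_subset_inter_left _ fun y hy => ?_)
    have : F y = ENNReal.ofReal (∑ i ∈ I, c i * (if ordered y i ≤ 0 then 1 else 0)) := by
      rw [ENNReal.ofReal_sum_of_nonneg]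
      · refine Finset.sum_congr rfl fun i _ => ?_
        by_cases h : ordered y i ≤ 0 <;> simp [h]
      · intro i _
        split_ifs <;> simp [hc i]
    rw [mem_ofPred_eq, this]
    exact ENNReal.ofReal_le_ofReal hy
  refine hset.trans ?_
  -- Markov's inequality; the common factor `s` is then cancelled.
  have hmk := (mul_meas_ge_le_lintegral₀ (μ := μ.restrict (absGe I K)) hF.aemeasurable
    (ENNReal.ofReal (ε * s))).trans h_int
  nth_rw 1 [mul_comm ε, ENNReal.ofReal_mul hI.le, mul_assoc] at hmk
  have h2 := (ENNReal.mul_le_mul_iff_right (by simpa using hI) ENNReal.ofReal_ne_top).1 hmk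
  rw [ENNReal.le_div_iff_mul_le (Or.inl (by simpa using hε)) (Or.inl ENNReal.ofReal_ne_top),
    mul_comm]
  exact h2

/-! ### The top ranks lie beyond `K` -/

/-- Chebyshev's inequality for the number of observations in `S`, with the crude variance bound `1`
per indicator. -/
lemma pi_card_le_le {G : Measure ℝ} [IsProbabilityMeasure G] {S : Set ℝ} (hS : MeasurableSet S)
    {x : ℝ} (hx : x < G.real S) {n : ℕ} (hn : 0 < n) :
    (Measure.pi fun _ : Fin n => G) {y | ∑ j, S.indicator 1 (y j) ≤ x * n} ≤
      ENNReal.ofReal ((n : ℝ)⁻¹ / (G.real S - x) ^ 2) := by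
  set μ := Measure.pi fun _ : Fin n => G
  let X : ℝ → ℝ := S.indicator 1
  have hXm : Measurable X := measurable_one.indicator hS
  have hX01 : ∀ t, X t ∈ Icc (0 : ℝ) 1 := fun t => by
    by_cases h : t ∈ S <;> simp [X, h]
  have hX : MemLp X 2 G := MemLp.of_bound hXm.aestronglyMeasurable 1 <| ae_of_all _ fun t => by
    rw [Real.norm_eq_abs, abs_of_nonneg (hX01 t).1]
    exact (hX01 t).2
  have hXj : ∀ j : Fin n, MemLp (fun y : Fin n → ℝ => X (y j)) 2 μ := fun j =>
    hX.comp_measurePreserving (measurePreserving_eval _ j)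
  let Z : (Fin n → ℝ) → ℝ := ∑ j, fun y => X (y j)
  have hZ : MemLp Z 2 μ := memLp_finsetSum' _ fun j _ => hXj j
  have hZe : μ[Z] = n * G.real S := by
    have h1 : ∀ j : Fin n, ∫ y, X (y j) ∂μ = G.real S := by
      intro j
      rw [← integral_indicator_one hS, ← (measurePreserving_eval (fun _ : Fin n => G) j).map_eq]
      exact (integral_map (measurable_pi_apply j).aemeasurable hXm.aestronglyMeasurable).symm
    simp only [Z, Finset.sum_apply]
    rw [integral_finsetSum _ fun j _ => (hXj j).integrable (by norm_num)]
    simp [h1]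
  have hvar : Var[Z; μ] ≤ n := by
    rw [variance_sum_pi fun _ => hX]
    refine (Finset.sum_le_card_nsmul _ _ 1 fun j _ => ?_).trans (by simp)
    refine (variance_le_sq_of_bounded (ae_of_all _ hX01) hXm.aemeasurable).trans ?_
    norm_num
  have hn' : (0 : ℝ) < n := by exact_mod_cast hn
  have hd : 0 < (G.real S - x) * n := mul_pos (by linarith) hn'
  refine (measure_mono fun y hy => ?_).trans ((meas_ge_le_variance_div_sq hZ hd).trans
    (ENNReal.ofReal_le_ofReal ?_))
  · rw [mem_ofPred_eq, hZe]
    have hy' : Z y ≤ x * n := by simpa [Z, X] using hy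
    rw [abs_sub_comm]
    refine le_trans ?_ (le_abs_self _)
    linarith
  · rw [div_le_div_iff₀ (by positivity) (pow_pos (by linarith) 2)]
    calc Var[Z; μ] * (G.real S - x) ^ 2 ≤ n * (G.real S - x) ^ 2 := by gcongr
      _ = (n : ℝ)⁻¹ * ((G.real S - x) * n) ^ 2 := by
        field_simp

/-- If an observation of top rank lies below `K` in absolute value, so do all those of lower rank,
which leaves few beyond `K`. -/
lemma compl_absGe_topRanks_subset {n : ℕ} {x : ℝ} (hx : x ≤ 1) (K : ℝ) :
    (absGe (topRanks n x) K)ᶜ ⊆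
      {y : Fin n → ℝ | ∑ j, {t : ℝ | K ≤ |t|}.indicator (1 : ℝ → ℝ) (y j) ≤ x * n} := by
  intro y hy
  simp only [absGe, mem_compl_iff, mem_ofPred_eq, not_forall, not_le] at hy
  obtain ⟨i, hi, hlt⟩ := hy
  have hi' : (1 - x) * ((n : ℝ) + 1) ≤ (i : ℝ) + 1 := by
    have := (Finset.mem_filter.1 hi).2
    rw [Int.ceil_le] at this
    exact_mod_cast this
  have hsum : ∑ j, {t : ℝ | K ≤ |t|}.indicator (1 : ℝ → ℝ) (y j) =
      ∑ k, {t : ℝ | K ≤ |t|}.indicator (1 : ℝ → ℝ) (ordered y k) :=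
    (Equiv.sum_comp (Tuple.sort fun j => |y j|)
      fun j => {t : ℝ | K ≤ |t|}.indicator (1 : ℝ → ℝ) (y j)).symm
  have hle : ∑ k, {t : ℝ | K ≤ |t|}.indicator (1 : ℝ → ℝ) (ordered y k) ≤
      ∑ k : Fin n, if k ∈ Finset.Ioi i then (1 : ℝ) else 0 := by
    refine Finset.sum_le_sum fun k _ => ?_
    by_cases hk : i < k
    · rw [if_pos (Finset.mem_Ioi.2 hk)]
      exact indicator_le_self' (by simp) _
    · have hmono := Tuple.monotone_sort (fun j => |y j|) (not_lt.1 hk)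
      rw [indicator_of_notMem]
      · split_ifs <;> simp
      · simp only [mem_ofPred_eq, not_le]
        exact lt_of_le_of_lt hmono hlt
  have hcard : (∑ k : Fin n, if k ∈ Finset.Ioi i then (1 : ℝ) else 0) = n - 1 - i := by
    have h1 : (i : ℕ) + 1 ≤ n := i.2
    rw [Finset.sum_ite_mem, Finset.univ_inter]
    simp only [Finset.sum_const, Fin.card_Ioi, nsmul_eq_mul, mul_one]
    rw [Nat.sub_sub, add_comm 1, Nat.cast_sub h1]
    push_cast
    ring
  rw [mem_ofPred_eq, hsum]
  refine hle.trans ?_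
  rw [hcard]
  -- `n - 1 - i ≤ n - (1 - x)(n + 1) = xn - (1 - x) ≤ xn`.
  nlinarith

/-! ### Growth of the sums of coefficients and of their squares -/

lemma IsScore.exists_continuousAt_pos {φ : ℝ → ℝ} (hφ : IsScore φ) {x : ℝ}
    (hx : x ∈ Ioc (0 : ℝ) 1) : ∃ q ∈ Ioo (1 - x) 1, ContinuousAt φ q ∧ 0 < φ q := by
  by_contra! h
  have hpos := hφ.mass_pos x hx
  rw [intervalIntegral.integral_of_le (by linarith [hx.1]), integral_Ioc_eq_integral_Ioo] at hpos
  refine hpos.not_ge (integral_nonpos_of_ae ?_)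
  have hae : ∀ᵐ q, q ∉ {q ∈ Ioo (0 : ℝ) 1 | ¬ ContinuousAt φ q} :=
    measure_eq_zero_iff_ae_notMem.1 hφ.ae_continuous
  filter_upwards [ae_restrict_of_ae hae, ae_restrict_mem measurableSet_Ioo] with q hq hq'
  refine h q hq' ?_
  by_contra hc
  exact hq ⟨⟨by linarith [hq'.1, hx.2], hq'.2⟩, hc⟩

lemma coeff_arg_mem_Ioo {n : ℕ} (i : Fin n) :
    ((i : ℕ) + 1 : ℝ) / ((n : ℝ) + 1) ∈ Ioo (0 : ℝ) 1 := by
  have h : ((i : ℕ) : ℝ) < n := by exact_mod_cast i.2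
  refine ⟨by positivity, ?_⟩
  rw [div_lt_one (by positivity)]
  linarith

lemma IsScore.coeff_nonneg {φ : ℝ → ℝ} (hφ : IsScore φ) {n : ℕ} (i : Fin n) :
    0 ≤ coeff φ n i :=
  hφ.nonneg _ (coeff_arg_mem_Ioo i)

lemma mem_topRanks {n : ℕ} {x : ℝ} {i : Fin n} :
    i ∈ topRanks n x ↔ (1 - x) * ((n : ℝ) + 1) ≤ (i : ℕ) + 1 := by
  rw [topRanks, Finset.mem_filter, Int.ceil_le]
  simp

lemma topRanks_mono {n : ℕ} {x x' : ℝ} (h : x ≤ x') : topRanks n x ⊆ topRanks n x' := by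
  intro i hi
  rw [mem_topRanks] at *
  refine le_trans ?_ hi
  gcongr

/-- An interval `(u, w]` inside `(0, 1)` contains about `(w - u) n` of the points `k / (n+1)`. -/
lemma le_card_filter_coeff_arg {u w : ℝ} (hu : 0 ≤ u) (hw : w < 1) (n : ℕ) :
    (w - u) * ((n : ℝ) + 1) - 1 ≤ ((Finset.univ.filter fun i : Fin n =>
      u < ((i : ℕ) + 1 : ℝ) / ((n : ℝ) + 1) ∧ ((i : ℕ) + 1 : ℝ) / ((n : ℝ) + 1) ≤ w).card : ℝ) := by
  have hn : (0 : ℝ) < (n : ℝ) + 1 := by positivity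
  have hcard : (Finset.Ioc ⌊u * ((n : ℝ) + 1)⌋₊ ⌊w * ((n : ℝ) + 1)⌋₊).card ≤
      (Finset.univ.filter fun i : Fin n => u < ((i : ℕ) + 1 : ℝ) / ((n : ℝ) + 1) ∧
        ((i : ℕ) + 1 : ℝ) / ((n : ℝ) + 1) ≤ w).card := by
    refine Finset.card_le_card_of_surjOn (fun i : Fin n => (i : ℕ) + 1) fun k hk => ?_
    rw [Finset.coe_Ioc, mem_Ioc] at hk
    have h1 : u * ((n : ℝ) + 1) < k := (Nat.floor_lt (by positivity)).1 hk.1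
    have hk0 : k ≠ 0 := by omega
    have h2 : (k : ℝ) ≤ w * ((n : ℝ) + 1) := (Nat.le_floor_iff' hk0).1 hk.2
    have h3 : k < n + 1 := by
      have : (k : ℝ) < (n : ℝ) + 1 := by nlinarith
      exact_mod_cast this
    have h4 : ((k - 1 : ℕ) : ℝ) + 1 = k := by
      rw [Nat.cast_sub (by omega)]
      simp
    refine ⟨⟨k - 1, by omega⟩, ?_, by simp; omega⟩
    simp only [Finset.coe_filter, Finset.mem_univ, true_and, mem_ofPred_eq, h4]
    exact ⟨(lt_div_iff₀ hn).2 h1, (div_le_iff₀ hn).2 h2⟩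
  refine le_trans ?_ (Nat.cast_le.2 hcard)
  rw [Nat.card_Ioc]
  have h1 : (⌊w * ((n : ℝ) + 1)⌋₊ : ℝ) - ⌊u * ((n : ℝ) + 1)⌋₊ ≤
      ((⌊w * ((n : ℝ) + 1)⌋₊ - ⌊u * ((n : ℝ) + 1)⌋₊ : ℕ) : ℝ) := by
    rw [sub_le_iff_le_add]
    exact_mod_cast le_tsub_add
  have h2 := Nat.lt_floor_add_one (w * ((n : ℝ) + 1))
  have h3 : (⌊u * ((n : ℝ) + 1)⌋₊ : ℝ) ≤ u * ((n : ℝ) + 1) := Nat.floor_le (by positivity)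
  linarith

/-- Around a continuity point `q` with `φ q > 0`, the score exceeds `φ q / 2` on an interval of
length `r`, which contains at least `(r/2) n` grid points once `rn ≥ 2`. -/
lemma IsScore.exists_le_sum_coeff {φ : ℝ → ℝ} (hφ : IsScore φ) {x : ℝ} (hx : x ∈ Ioc (0 : ℝ) 1) :
    ∃ s > 0, ∀ᶠ n : ℕ in atTop, s * n ≤ ∑ i ∈ topRanks n x, coeff φ n i := by
  obtain ⟨q, hq, hcont, hpos⟩ := hφ.exists_continuousAt_pos hx
  have hev : ∀ᶠ t in 𝓝 q, φ q / 2 < φ t ∧ t ∈ Ioo (1 - x) 1 :=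
    (hcont.eventually (lt_mem_nhds (half_lt_self hpos))).and (Ioo_mem_nhds hq.1 hq.2)
  obtain ⟨r, hr, hball⟩ := Metric.eventually_nhds_iff_ball.1 hev
  have hin : ∀ t ∈ Icc (q - r / 2) (q + r / 2), φ q / 2 < φ t ∧ t ∈ Ioo (1 - x) 1 := by
    intro t ht
    apply hball
    rw [Real.ball_eq_Ioo]
    exact ⟨by linarith [ht.1], by linarith [ht.2]⟩
  have hu := (hin (q - r / 2) ⟨le_rfl, by linarith⟩).2
  have hw := (hin (q + r / 2) ⟨by linarith, le_rfl⟩).2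
  refine ⟨φ q / 2 * (r / 2), by positivity, ?_⟩
  filter_upwards [eventually_ge_atTop ⌈2 / r⌉₊] with n hn
  have hn' : 2 ≤ n * r := (div_le_iff₀ hr).1 ((Nat.le_ceil _).trans (Nat.cast_le.2 hn))
  set J := Finset.univ.filter fun i : Fin n => q - r / 2 < ((i : ℕ) + 1 : ℝ) / ((n : ℝ) + 1) ∧
    ((i : ℕ) + 1 : ℝ) / ((n : ℝ) + 1) ≤ q + r / 2 with hJ
  have hJi : ∀ i ∈ J, φ q / 2 < coeff φ n i ∧
      ((i : ℕ) + 1 : ℝ) / ((n : ℝ) + 1) ∈ Ioo (1 - x) 1 := by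
    intro i hi
    have := (Finset.mem_filter.1 hi).2
    exact hin _ ⟨this.1.le, this.2⟩
  have hcard := le_card_filter_coeff_arg (by linarith [hu.1, hx.2] : 0 ≤ q - r / 2) hw.2 n
  rw [← hJ] at hcard
  have hJsub : J ⊆ topRanks n x := fun i hi => by
    rw [mem_topRanks]
    exact ((lt_div_iff₀ (by positivity)).1 (hJi i hi).2.1).le
  calc φ q / 2 * (r / 2) * n = r / 2 * n * (φ q / 2) := by ring
    _ ≤ J.card * (φ q / 2) := by
        gcongr
        nlinarith
    _ ≤ ∑ i ∈ J, coeff φ n i := by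
        rw [← nsmul_eq_mul]
        exact Finset.card_nsmul_le_sum _ _ _ fun i hi => (hJi i hi).1.le
    _ ≤ ∑ i ∈ topRanks n x, coeff φ n i :=
        Finset.sum_le_sum_of_subset_of_nonneg hJsub fun i _ _ => hφ.coeff_nonneg i

lemma IsScore.intervalIntegrable_sq {φ : ℝ → ℝ} (hφ : IsScore φ) {a b : ℝ}
    (ha : a ∈ Icc (0 : ℝ) 1) (hb : b ∈ Icc (0 : ℝ) 1) :
    IntervalIntegrable (fun q => φ q ^ 2) volume a b := by
  have h : IntervalIntegrable (fun q => φ q ^ 2) volume 0 1 := by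
    rw [intervalIntegrable_iff_integrableOn_Ioo_of_le zero_le_one]
    exact hφ.sq_integrable
  refine h.mono_set ?_
  rw [uIcc_of_le (zero_le_one' ℝ)]
  exact uIcc_subset_Icc ha hb

lemma IsScore.mul_sq_le_integral {φ : ℝ → ℝ} (hφ : IsScore φ) {a b q : ℝ}
    (ha : 0 ≤ a) (hab : a ≤ b) (hb : b ≤ 1) (hq : q ∈ Ioo (0 : ℝ) 1)
    (h : ∀ t ∈ Ioo a b, φ q ≤ φ t) : (b - a) * φ q ^ 2 ≤ ∫ t in a..b, φ t ^ 2 := by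
  rw [← smul_eq_mul, ← intervalIntegral.integral_const]
  refine intervalIntegral.integral_mono_on_of_le_Ioo hab (by simp)
    (hφ.intervalIntegrable_sq ⟨ha, hab.trans hb⟩ ⟨ha.trans hab, hb⟩) fun t ht => ?_
  exact pow_le_pow_left₀ (hφ.nonneg q hq) (h t ht) 2

/-- Near the end points, monotonicity bounds `φ(k/(n+1))²` by `n + 1` times the integral of `φ²`
over the adjacent cell on the side of the nearer end point. These integrals add up to at most `∫ φ²`
at each end, and in between `φ` is bounded. -/
lemma IsScore.exists_sum_sq_le {φ : ℝ → ℝ} (hφ : IsScore φ) :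
    ∃ M > 0, ∀ n : ℕ, 0 < n → ∑ i : Fin n, coeff φ n i ^ 2 ≤ M * n := by
  obtain ⟨a, ha, hanti, hmono, M, hM⟩ := hφ.tails
  -- The bound in (P3) covers only the open interval, so the values at `a` and `1 - a` are added.
  set B := M ^ 2 + φ a ^ 2 + φ (1 - a) ^ 2 with hB
  set F := ∫ t in (0 : ℝ)..1, φ t ^ 2 with hF
  have hnn : ∀ b c : ℝ, b ≤ c → 0 ≤ ∫ t in b..c, φ t ^ 2 := fun b c hbc =>
    intervalIntegral.integral_nonneg hbc fun t _ => sq_nonneg _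
  have hF0 : 0 ≤ F := hnn 0 1 zero_le_one
  have hB0 : 0 ≤ B := by positivity
  refine ⟨B + 4 * F + 1, by positivity, fun n hn => ?_⟩
  have hn1 : (1 : ℝ) ≤ n := by exact_mod_cast hn
  have hN : (0 : ℝ) < (n : ℝ) + 1 := by positivity
  let g : ℕ → ℝ := fun k => (k : ℝ) / ((n : ℝ) + 1)
  have hg : ∀ k, k ≤ n + 1 → g k ∈ Icc (0 : ℝ) 1 := by
    intro k hk
    refine ⟨by positivity, (div_le_one hN).2 ?_⟩
    exact_mod_cast hk
  have hgs : ∀ k, g k ≤ g (k + 1) := fun k => by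
    simp only [g]
    gcongr
    simp
  have hgd : ∀ k, g (k + 1) - g k = ((n : ℝ) + 1)⁻¹ := fun k => by
    simp only [g]
    push_cast
    field_simp
    ring
  have hpt : ∀ k, k < n → φ (g (k + 1)) ^ 2 ≤ B +
      (((n : ℝ) + 1) * (∫ t in g k..g (k + 1), φ t ^ 2) +
        ((n : ℝ) + 1) * ∫ t in g (k + 1)..g (k + 1 + 1), φ t ^ 2) := by
    intro k hk
    have hq : g (k + 1) ∈ Ioo (0 : ℝ) 1 := by
      have := coeff_arg_mem_Ioo (⟨k, hk⟩ : Fin n)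
      simpa [g] using this
    have h1 : 0 ≤ ((n : ℝ) + 1) * (∫ t in g k..g (k + 1), φ t ^ 2) :=
      mul_nonneg hN.le (hnn _ _ (hgs _))
    have h2 : 0 ≤ ((n : ℝ) + 1) * (∫ t in g (k + 1)..g (k + 1 + 1), φ t ^ 2) :=
      mul_nonneg hN.le (hnn _ _ (hgs _))
    rcases lt_or_ge (g (k + 1)) a with hlt | hge
    · have h := hφ.mul_sq_le_integral (hg k (by omega)).1 (hgs k) hq.2.le hq fun t ht =>
        hanti ⟨(hg k (by omega)).1.trans_lt ht.1, ht.2.trans hlt⟩ ⟨hq.1, hlt⟩ ht.2.le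
      rw [hgd, inv_mul_le_iff₀ hN] at h
      linarith
    rcases lt_or_ge (1 - a) (g (k + 1)) with hlt' | hge'
    · have h := hφ.mul_sq_le_integral hq.1.le (hgs (k + 1)) (hg (k + 1 + 1) (by omega)).2 hq
        fun t ht => hmono ⟨hlt', hq.2⟩
          ⟨hlt'.trans ht.1, ht.2.trans_le (hg (k + 1 + 1) (by omega)).2⟩ ht.1.le
      rw [hgd, inv_mul_le_iff₀ hN] at h
      linarith
    have hle : φ (g (k + 1)) ^ 2 ≤ B := by
      rcases hge.eq_or_lt with he | hlt
      · rw [← he]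
        linarith [sq_nonneg M, sq_nonneg (φ (1 - a))]
      rcases hge'.eq_or_lt with he' | hlt'
      · rw [he']
        linarith [sq_nonneg M, sq_nonneg (φ a)]
      have := pow_le_pow_left₀ (hφ.nonneg _ hq) (hM _ ⟨hlt, hlt'⟩) 2
      linarith [sq_nonneg (φ a), sq_nonneg (φ (1 - a))]
    linarith
  have hsub : ∀ b c : ℝ, 0 ≤ b → b ≤ c → c ≤ 1 → ∫ t in b..c, φ t ^ 2 ≤ F := by
    intro b c hb hbc hc
    exact intervalIntegral.integral_mono_interval hb hbc hc (ae_of_all _ fun t => sq_nonneg _)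
      (hφ.intervalIntegrable_sq (by simp) (by simp))
  have hS1 : ∑ k ∈ Finset.range n, ∫ t in g k..g (k + 1), φ t ^ 2 ≤ F := by
    rw [intervalIntegral.sum_integral_adjacent_intervals fun k hk =>
      hφ.intervalIntegrable_sq (hg k (by omega)) (hg (k + 1) (by omega))]
    exact hsub _ _ (hg 0 (by omega)).1 (by simp only [g]; gcongr) (hg n (by omega)).2
  have hS2 : ∑ k ∈ Finset.range n, ∫ t in g (k + 1)..g (k + 1 + 1), φ t ^ 2 ≤ F := by
    rw [intervalIntegral.sum_integral_adjacent_intervals (a := fun k => g (k + 1)) fun k hk =>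
      hφ.intervalIntegrable_sq (hg (k + 1) (by omega)) (hg (k + 1 + 1) (by omega))]
    exact hsub _ _ (hg (0 + 1) (by omega)).1 (by simp only [g]; gcongr)
      (hg (n + 1) (by omega)).2
  calc ∑ i : Fin n, coeff φ n i ^ 2 = ∑ k ∈ Finset.range n, φ (g (k + 1)) ^ 2 := by
        rw [Finset.sum_range]
        simp [coeff, g]
    _ ≤ ∑ k ∈ Finset.range n, (B + (((n : ℝ) + 1) * (∫ t in g k..g (k + 1), φ t ^ 2) +
        ((n : ℝ) + 1) * ∫ t in g (k + 1)..g (k + 1 + 1), φ t ^ 2)) :=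
        Finset.sum_le_sum fun k hk => hpt k (Finset.mem_range.1 hk)
    _ = n * B + (((n : ℝ) + 1) * ∑ k ∈ Finset.range n, (∫ t in g k..g (k + 1), φ t ^ 2) +
        ((n : ℝ) + 1) * ∑ k ∈ Finset.range n, ∫ t in g (k + 1)..g (k + 1 + 1), φ t ^ 2) := by
        simp [Finset.sum_add_distrib, Finset.mul_sum]
    _ ≤ n * B + (((n : ℝ) + 1) * F + ((n : ℝ) + 1) * F) := by gcongr
    _ ≤ (B + 4 * F + 1) * n := by nlinarith

/-! ### The threshold -/

/-- Apply `exp u - 1 ≤ u exp u` twice: `u exp u = u + u (exp u - 1) ≤ u + u² exp u`. -/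
lemma exp_sub_one_le {u B : ℝ} (hu : 0 ≤ u) (huB : u ≤ B) :
    Real.exp u - 1 ≤ u + Real.exp B * u ^ 2 := by
  have h1 : Real.exp u - 1 ≤ u * Real.exp u := by
    have h := Real.add_one_le_exp (-u)
    have h2 : Real.exp (-u) * Real.exp u = 1 := by rw [← Real.exp_add]; simp
    nlinarith [Real.exp_pos u]
  have h2 : Real.exp u ≤ Real.exp B := Real.exp_le_exp.2 huB
  have h3 := Real.add_one_le_exp u
  have h4 : Real.exp u * u ^ 2 ≤ Real.exp B * u ^ 2 := by gcongr
  nlinarith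

lemma rho_mem_Ioo {Γ : ℝ} (hΓ : 1 ≤ Γ) : rho Γ ∈ Ioo (0 : ℝ) 1 := by
  refine ⟨by unfold rho; positivity, ?_⟩
  rw [rho, div_lt_one (by positivity)]
  linarith

/-- The uniform threshold exceeds `ρ ∑ c_i` by at most a multiple of `√n`. -/
lemma IsScore.exists_threshold_le {φ : ℝ → ℝ} (hφ : IsScore φ) {α : ℝ} (hα : α ∈ Ioo (0 : ℝ) 1)
    {x₀ : ℝ} (hx₀ : 0 < x₀) {Γ : ℝ} (hΓ : 1 ≤ Γ) :
    ∃ D, ∀ᶠ n : ℕ in atTop, 0 < nullVar φ Γ n x₀ ∧ ∀ x, threshold φ α x₀ Γ n x ≤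
      rho Γ * (∑ i ∈ topRanks n x, coeff φ n i) + D * √n := by
  -- The tuning parameter `x₀` may exceed `1`, whereas (P4) is available only up to `1`.
  obtain ⟨s, hs, hsn⟩ := hφ.exists_le_sum_coeff (x := min x₀ 1)
    ⟨lt_min hx₀ one_pos, min_le_right _ _⟩
  obtain ⟨M, hM, hMn⟩ := hφ.exists_sum_sq_le
  obtain ⟨hp0, hp1⟩ := rho_mem_Ioo hΓ
  set p := rho Γ
  set L := Real.log α⁻¹ with hL
  have hLpos : 0 < L := Real.log_pos ((one_lt_inv₀ hα.1).2 hα.2)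
  have hκ : 0 < p * (1 - p) := mul_pos hp0 (by linarith)
  -- From `s² n ≤ W ≤ M n` the parameter `λ_n` has exact order `n^(-1/2)`: `b` bounds `λ_n √n` and
  -- `e` bounds `1 / (λ_n √n)`.
  set b := √(2 * L / (p * (1 - p) * s ^ 2)) with hb
  set e := √(p * (1 - p) * M / (2 * L)) with he
  refine ⟨L * e + p * (Real.exp (√M * b) * (b * M)), ?_⟩
  filter_upwards [hsn, eventually_gt_atTop 0] with n hsn hn
  have hn' : (0 : ℝ) < n := by exact_mod_cast hn
  have hsq := hMn n hn
  set W := ∑ i ∈ topRanks n x₀, coeff φ n i ^ 2 with hW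
  have hWub : W ≤ M * n := (Finset.sum_le_sum_of_subset_of_nonneg (Finset.subset_univ _)
    fun i _ _ => sq_nonneg _).trans hsq
  -- Cauchy-Schwarz turns the linear lower bound on `∑ c_i` into one on `∑ c_i²`.
  have hWlb : s ^ 2 * n ≤ W := by
    have h1 : (s * n) ^ 2 ≤ n * W :=
      calc (s * n) ^ 2 ≤ (∑ i ∈ topRanks n (min x₀ 1), coeff φ n i) ^ 2 := by gcongr
        _ ≤ (topRanks n (min x₀ 1)).card * ∑ i ∈ topRanks n (min x₀ 1), coeff φ n i ^ 2 :=
            sq_sum_le_card_mul_sum_sq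
        _ ≤ n * W := by
            gcongr
            · simpa using Finset.card_le_univ (topRanks n (min x₀ 1))
            · exact Finset.sum_le_sum_of_subset_of_nonneg (topRanks_mono (min_le_left _ _))
                fun i _ _ => sq_nonneg _
    have h2 : n * (s ^ 2 * n) ≤ n * W := by linarith
    exact le_of_mul_le_mul_left h2 hn'
  have hWpos : 0 < W := lt_of_lt_of_le (by positivity) hWlb
  have hV : nullVar φ Γ n x₀ = p * (1 - p) * W := rfl
  have hVpos : 0 < nullVar φ Γ n x₀ := hV ▸ mul_pos hκ hWpos
  refine ⟨hVpos, fun x => ?_⟩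
  set l := lam φ α x₀ Γ n with hl
  have hldef : l = √(2 * L / (p * (1 - p) * W)) := rfl
  have hlpos : 0 < l := Real.sqrt_pos.2 (div_pos (by linarith) hVpos)
  have hlb : l * √n ≤ b := by
    rw [hldef, ← Real.sqrt_mul (by positivity), hb]
    apply Real.sqrt_le_sqrt
    rw [div_mul_eq_mul_div, div_le_div_iff₀ (by positivity) (by positivity)]
    have : 0 ≤ 2 * L * (p * (1 - p)) := by positivity
    nlinarith
  have hle : 1 / l ≤ e * √n := by
    rw [hldef, one_div, ← Real.sqrt_inv, inv_div, he, ← Real.sqrt_mul (by positivity)]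
    apply Real.sqrt_le_sqrt
    rw [div_mul_eq_mul_div, mul_assoc _ M]
    gcongr
  have hc0 : ∀ i : Fin n, 0 ≤ coeff φ n i := hφ.coeff_nonneg
  -- Although `φ` may be unbounded, `c_i² ≤ ∑ c_j² ≤ M n` keeps the exponents `c_i λ_n` bounded.
  have hcl : ∀ i : Fin n, coeff φ n i * l ≤ √M * b := by
    intro i
    have h1 : coeff φ n i ≤ √M * √n := by
      rw [← Real.sqrt_mul hM.le]
      refine Real.le_sqrt_of_sq_le (le_trans ?_ hsq)
      exact Finset.single_le_sum (f := fun i => coeff φ n i ^ 2) (fun i _ => sq_nonneg _)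
        (Finset.mem_univ i)
    calc coeff φ n i * l ≤ √M * √n * l := by gcongr
      _ = √M * (l * √n) := by ring
      _ ≤ √M * b := by gcongr
  have hlog : ∀ i : Fin n, Real.log (1 + p * (Real.exp (coeff φ n i * l) - 1)) ≤
      l * (p * coeff φ n i) + p * (Real.exp (√M * b) * l ^ 2) * coeff φ n i ^ 2 := by
    intro i
    have hu : 0 ≤ coeff φ n i * l := mul_nonneg (hc0 i) hlpos.le
    have h0 : 0 ≤ Real.exp (coeff φ n i * l) - 1 := by linarith [Real.one_le_exp hu]
    calc Real.log (1 + p * (Real.exp (coeff φ n i * l) - 1))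
        ≤ (1 + p * (Real.exp (coeff φ n i * l) - 1)) - 1 :=
          Real.log_le_sub_one_of_pos (by positivity)
      _ = p * (Real.exp (coeff φ n i * l) - 1) := by ring
      _ ≤ p * (coeff φ n i * l + Real.exp (√M * b) * (coeff φ n i * l) ^ 2) := by
          gcongr
          exact exp_sub_one_le hu (hcl i)
      _ = _ := by ring
  have hS2 : ∑ i ∈ topRanks n x, coeff φ n i ^ 2 ≤ M * n :=
    (Finset.sum_le_sum_of_subset_of_nonneg (Finset.subset_univ _)
      fun i _ _ => sq_nonneg _).trans hsq
  have hsn2 : √(n : ℝ) * √n = n := Real.mul_self_sqrt hn'.le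
  calc threshold φ α x₀ Γ n x
      = 1 / l * (L + ∑ i ∈ topRanks n x,
          Real.log (1 + p * (Real.exp (coeff φ n i * l) - 1))) := by
        rw [threshold, one_div α]
    _ ≤ 1 / l * (L + ∑ i ∈ topRanks n x, (l * (p * coeff φ n i) +
          p * (Real.exp (√M * b) * l ^ 2) * coeff φ n i ^ 2)) := by
        gcongr with i
        exact hlog i
    _ = p * (∑ i ∈ topRanks n x, coeff φ n i) + (L * (1 / l) +
          p * (Real.exp (√M * b) * (l * ∑ i ∈ topRanks n x, coeff φ n i ^ 2))) := by
        rw [Finset.sum_add_distrib, ← Finset.mul_sum, ← Finset.mul_sum, ← Finset.mul_sum]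
        field_simp
        ring
    _ ≤ p * (∑ i ∈ topRanks n x, coeff φ n i) + (L * (e * √n) +
          p * (Real.exp (√M * b) * (l * (M * n)))) := by gcongr
    _ = p * (∑ i ∈ topRanks n x, coeff φ n i) + (L * (e * √n) +
          p * (Real.exp (√M * b) * (l * √n * M * √n))) := by
        rw [show l * √n * M * √n = l * (M * (√n * √n)) by ring, hsn2]
    _ ≤ p * (∑ i ∈ topRanks n x, coeff φ n i) + (L * (e * √n) +
          p * (Real.exp (√M * b) * (b * M * √n))) := by gcongr
    _ = _ := by ring

lemma stat_add_sum_nonpos (φ : ℝ → ℝ) {n : ℕ} (y : Fin n → ℝ) (x : ℝ) :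
    stat φ y x + ∑ i ∈ topRanks n x, coeff φ n i * (if ordered y i ≤ 0 then 1 else 0) =
      ∑ i ∈ topRanks n x, coeff φ n i := by
  rw [stat, ← Finset.sum_add_distrib]
  refine Finset.sum_congr rfl fun i _ => ?_
  rcases lt_or_ge 0 (ordered y i) with h | h
  · simp [h, h.not_ge]
  · simp [h, h.not_gt]

/-! ### Consistency of the test -/

/-- If the negative tail of `G` becomes negligible relative to the whole tail, then the power of the
uniform test tends to one. -/
theorem IsScore.tendsto_power {φ : ℝ → ℝ} (hφ : IsScore φ) {G : Measure ℝ} [IsProbabilityMeasure G]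
    (hG : ∀ η : ℝ, 0 < η → ∃ K, NegTailLe G K (ENNReal.ofReal η) ∧ 0 < G.real {t | K ≤ |t|})
    {α : ℝ} (hα : α ∈ Ioo (0 : ℝ) 1) {x₀ : ℝ} (hx₀ : 0 < x₀) {Γ : ℝ} (hΓ : 1 ≤ Γ) :
    Tendsto (fun n => power φ G α x₀ Γ n) atTop (𝓝 1) := by
  have hle1 : ∀ n, power φ G α x₀ Γ n ≤ 1 := fun n => measureReal_le_one
  obtain ⟨-, hp1⟩ := rho_mem_Ioo hΓ
  -- Half of the gap `1 - ρ`: one half absorbs the loss from nonpositive observations, the other the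
  -- `D √n` of the threshold.
  set ε := (1 - rho Γ) / 2 with hε
  have hεpos : 0 < ε := by
    rw [hε]
    linarith
  obtain ⟨D, hD⟩ := hφ.exists_threshold_le hα hx₀ hΓ
  refine tendsto_order.2 ⟨fun a ha => ?_, fun a ha => Eventually.of_forall fun n =>
    (hle1 n).trans_lt ha⟩
  set δ := (1 - a) / 3 with hδ
  have hδpos : 0 < δ := by
    rw [hδ]
    linarith
  -- With `η = δ ε`, Markov's bound `η / ε` equals `δ`.
  obtain ⟨K, hK, hP⟩ := hG (δ * ε) (by positivity)
  set P := G.real {t | K ≤ |t|}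
  have hP1 : P ≤ 1 := measureReal_le_one
  -- Taking `x = P/2` below the mass `P` beyond `K` leaves Chebyshev a margin.
  have hx : P / 2 ∈ Ioo (0 : ℝ) 1 := ⟨by linarith, by linarith⟩
  obtain ⟨s, hs, hsn⟩ := hφ.exists_le_sum_coeff ⟨hx.1, hx.2.le⟩
  have hsqrt : ∀ᶠ n : ℕ in atTop, D ≤ ε * s * √n :=
    ((Real.tendsto_sqrt_atTop.comp tendsto_natCast_atTop_atTop).const_mul_atTop
      (by positivity : 0 < ε * s)).eventually_ge_atTop D
  have hcheb : ∀ᶠ n : ℕ in atTop, (n : ℝ)⁻¹ / (P - P / 2) ^ 2 < δ := by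
    have h : Tendsto (fun n : ℕ => (n : ℝ)⁻¹ / (P - P / 2) ^ 2) atTop (𝓝 0) := by
      simpa using (tendsto_inv_atTop_nhds_zero_nat (𝕜 := ℝ)).div_const ((P - P / 2) ^ 2)
    exact h.eventually (gt_mem_nhds hδpos)
  filter_upwards [hD, hsn, hsqrt, hcheb, eventually_gt_atTop 0] with n hDn hsn hsqrt hcheb hn
  set μ := Measure.pi fun _ : Fin n => G
  set I := topRanks n (P / 2)
  set S := ∑ i ∈ I, coeff φ n i
  have hn' : (0 : ℝ) < n := by exact_mod_cast hn
  have hS : 0 < S := lt_of_lt_of_le (by positivity) hsn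
  set E := absGe I K ∩
    {y | ε * S ≤ ∑ i ∈ I, coeff φ n i * (if ordered y i ≤ 0 then 1 else 0)} with hE
  have hsub : {y | Rejects φ α x₀ Γ y}ᶜ ⊆ (absGe I K)ᶜ ∪ E := by
    intro y hy
    by_contra hcon
    simp only [hE, mem_union, mem_compl_iff, mem_inter_iff, not_or, not_not, not_and] at hcon
    have hlt := hcon.2 hcon.1
    simp only [mem_ofPred_eq, not_le] at hlt
    refine hy ⟨hDn.1, P / 2, hx, (hDn.2 _).trans ?_⟩
    have h1 : stat φ y (P / 2) +
      ∑ i ∈ I, coeff φ n i * (if ordered y i ≤ 0 then 1 else 0) = S := stat_add_sum_nonpos φ y _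
    have h2 : D * √n ≤ ε * S :=
      calc D * √n ≤ ε * s * √n * √n := by gcongr
        _ = ε * (s * n) := by
          rw [mul_assoc, Real.mul_self_sqrt hn'.le, mul_assoc]
        _ ≤ ε * S := by gcongr
    have h3 : rho Γ * S = S - 2 * (ε * S) := by
      rw [hε]
      ring
    change rho Γ * S + D * √n ≤ stat φ y (P / 2)
    linarith
  have hA : μ (absGe I K)ᶜ ≤ ENNReal.ofReal δ :=
    calc μ (absGe I K)ᶜ ≤ _ := measure_mono (compl_absGe_topRanks_subset hx.2.le K)
      _ ≤ _ := pi_card_le_le (S := {t | K ≤ |t|})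
          (measurableSet_le measurable_const measurable_norm) (half_lt_self hP) hn
      _ ≤ ENNReal.ofReal δ := ENNReal.ofReal_le_ofReal hcheb.le
  have hEle : μ E ≤ ENNReal.ofReal δ := by
    refine (hK.pi_sum_nonpos_ge_le ENNReal.ofReal_ne_top hφ.coeff_nonneg hS hεpos).trans ?_
    rw [← ENNReal.ofReal_div_of_pos hεpos, mul_div_cancel_right₀ _ hεpos.ne']
  have hc : μ {y | Rejects φ α x₀ Γ y}ᶜ ≤ ENNReal.ofReal (δ + δ) := by
    rw [ENNReal.ofReal_add hδpos.le hδpos.le]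
    exact (measure_mono hsub).trans ((measure_union_le _ _).trans (add_le_add hA hEle))
  have hcr : μ.real {y | Rejects φ α x₀ Γ y}ᶜ ≤ δ + δ :=
    ENNReal.toReal_le_of_le_ofReal (by positivity) hc
  -- Subadditivity avoids the need for measurability of the rejection event.
  have hone : 1 ≤ μ.real {y | Rejects φ α x₀ Γ y} + μ.real {y | Rejects φ α x₀ Γ y}ᶜ := by
    have h := measureReal_union_le (μ := μ) {y | Rejects φ α x₀ Γ y} {y | Rejects φ α x₀ Γ y}ᶜ
    rwa [union_compl_self, probReal_univ] at h
  change a < μ.real {y | Rejects φ α x₀ Γ y}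
  linarith

lemma exists_negTailLe_gaussianReal {τ : ℝ} (hτ : 0 < τ) {v : ℝ≥0} (hv : v ≠ 0) {η : ℝ}
    (hη : 0 < η) : ∃ K, NegTailLe (gaussianReal τ v) K (ENNReal.ofReal η) ∧
      0 < (gaussianReal τ v).real {t | K ≤ |t|} := by
  have hc : 0 < 2 * τ / v := by positivity
  have hlim : Tendsto (fun K : ℝ => Real.exp (-(2 * τ / v * K))) atTop (𝓝 0) :=
    Real.tendsto_exp_neg_atTop_nhds_zero.comp (tendsto_id.const_mul_atTop hc)
  obtain ⟨K, hK⟩ := (hlim.eventually (gt_mem_nhds hη)).exists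
  refine ⟨K, fun S hS hneg hKS => (gaussianReal_inter_Iic_le hτ.le hv hS hneg hKS).trans ?_, ?_⟩
  · gcongr
  · rw [measureReal_def, ENNReal.toReal_pos_iff]
    refine ⟨pos_iff_ne_zero.2 fun h0 => ?_, measure_lt_top _ _⟩
    have h1 : volume (Ici K) = 0 :=
      measure_mono_null (fun t ht => le_trans ht (le_abs_self t))
        (gaussianReal_absolutelyContinuous' τ hv h0)
    simp at h1

end SignedRank

theorem mainTheorem4 (φ : ℝ → ℝ) (hφ : SignedRank.IsScore φ)
    (τ : ℝ) (hτ : 0 < τ) (σ : ℝ≥0) (hσ : 0 < σ) :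
    SignedRank.unifSensitivity φ (gaussianReal τ (σ ^ 2)) = ⊤ ∧
    ∀ α ∈ Ioo (0 : ℝ) 1, ∀ x₀ : ℝ, 0 < x₀ →
      SignedRank.IsDesignSensitivity
        (fun Γ n => SignedRank.power φ (gaussianReal τ (σ ^ 2)) α x₀ Γ n) ⊤ ∧
      ∀ Γ : ℝ, 1 ≤ Γ →
        Tendsto (fun n => SignedRank.power φ (gaussianReal τ (σ ^ 2)) α x₀ Γ n) atTop (𝓝 1) := by
  have hv : σ ^ 2 ≠ 0 := pow_ne_zero 2 hσ.ne'
  refine ⟨SignedRank.unifSensitivity_gaussianReal hφ hτ hv, fun α hα x₀ hx₀ => ?_⟩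
  have hpow : ∀ Γ : ℝ, 1 ≤ Γ →
      Tendsto (fun n => SignedRank.power φ (gaussianReal τ (σ ^ 2)) α x₀ Γ n) atTop (𝓝 1) :=
    fun Γ hΓ => hφ.tendsto_power
      (fun η hη => SignedRank.exists_negTailLe_gaussianReal hτ hv hη) hα hx₀ hΓ
  -- The second half of `IsDesignSensitivity` is vacuous at `⊤`.
  exact ⟨⟨fun Γ hΓ _ => hpow Γ hΓ, fun Γ _ h => absurd h not_top_lt⟩, hpow⟩
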